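/- Let $n\ge 3$ and $S,P>0$. Let $\mathcal M=\{x\in\mathbb R^n: x_i>0 \text{ for all } i,\ \sum_{i=1}^n x_i=S,\ \prod_{i=1}^n x_i=P\}$ and $\mathcal M^+=\{x\in\mathcal M: x_1\ge x_2\}$. For $(x_3,\dots,x_n)\in\mathbb R^{n-2}$ write $s=\sum_{i=3}^n x_i$, $p=\prod_{i=3}^n x_i$, and let $$\mathcal U=\{(x_3,\dots,x_n): x_i>0 \text{ for all } i,\ s<S,\ p>4P/(S-s)^2\},$$ $$f(x_3,\dots,x_n)=(f_1,f_2,x_3,\dots,x_n),\qquad f_{1},f_2=\tfrac12\Big((S-s)\pm\sqrt{(S-s)^2-4P/p}\Big),$$ with the sign $+$ for $f_1$ and $-$ for $f_2$. Let $\bar{\mathcal H}^{n-2}$ be the $(n-2)$-dimensional area measure, that is, $(n-2)$-dimensional Hausdorff measure normalized so that it agrees with Lebesgue measure on $\mathbb R^{n-2}$. For $y\in\mathcal U$ let $J_{n-2}f(y)$ be the $(n-2)$-dimensional Jacobian of $f$ at $y$: the maximal $(n-2)$-dimensional volume of the image under $Df(y)$ of a unit $(n-2)$-dimensional cube, over all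 rotations of the cube. Then $\mathcal U$ is open and $f$ is a smooth injective map from $\mathcal U$ onto $\{x\in\mathcal M^+: x_1>x_2\}$; the remaining part of $\mathcal M^+$, where $x_1=x_2$, has $\bar{\mathcal H}^{n-2}$-measure zero. The density of $\bar{\mathcal H}^{n-2}$ on $\mathcal M^+$ in the coordinates given by $f$ is $J_{n-2}f$: for every Borel set $B\subseteq\mathbb R^n$, $$\bar{\mathcal H}^{n-2}(B\cap\mathcal M^+)=\int_{\mathcal U\cap f^{-1}(B)}J_{n-2}f(y)\,dy .$$ Moreover, at every point of $\mathcal U$ the $n\times(n-2)$ derivative matrix is $$Df=\begin{bmatrix}D_3f_1&\cdots&D_nf_1\\ D_3f_2&\cdots&D_nf_2\\ &I_{n-2}&\end{bmatrix},$$ $J_{n-2}f$ is finite, and if $V^T$ and $W^T$ are the first and second rows of $Df$, then $$(J_{n-2}f)^2=\det\left(I_2+\begin{pmatrix}V^TV&V^TW\\ V^TW&W^TW\end{pmatrix}\right).$$ -/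

import Mathlib

open MeasureTheory
open scoped ENNReal ContDiff

noncomputable section

namespace FixedSumProduct

/-! ### Jacobians of maps between Euclidean spaces

The `d`-dimensional area measure is Mathlib's Euclidean Hausdorff measure `μHE[d]`: the
`d`-dimensional Hausdorff measure, normalized so that it agrees with Lebesgue measure on `ℝ^d`. -/

/-- The unit cube `[0,1]^k` in `ℝ^k`. -/
def unitCube (k : ℕ) : Set (EuclideanSpace ℝ (Fin k)) :=
  {u | ∀ i, 0 ≤ u i ∧ u i ≤ 1}

/-- The `k`-dimensional Jacobian of `g` at `x`: the largest `k`-dimensional volume of the image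
under `Dg(x)` of a unit `k`-dimensional cube in `ℝ^m`. The cubes are the images of `[0,1]^k` under
all linear isometric embeddings `Q` of `ℝ^k` into `ℝ^m`. -/
def jacobian {m n : ℕ} (k : ℕ) (g : EuclideanSpace ℝ (Fin m) → EuclideanSpace ℝ (Fin n))
    (x : EuclideanSpace ℝ (Fin m)) : ℝ≥0∞ :=
  ⨆ Q : EuclideanSpace ℝ (Fin k) →ₗᵢ[ℝ] EuclideanSpace ℝ (Fin m),
    μHE[k] (fderiv ℝ g x '' (Q '' unitCube k))

/-- The row `(D_1 h(x), …, D_m h(x))` of partial derivatives of a real function `h`. -/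
def partials {m : ℕ} (h : EuclideanSpace ℝ (Fin m) → ℝ) (x : EuclideanSpace ℝ (Fin m)) :
    Fin m → ℝ :=
  fun j => fderiv ℝ h x (EuclideanSpace.single j 1)

/-- The `n × m` derivative matrix of `g` at `x`; its `i`-th row holds the partial derivatives of
the `i`-th component. -/
def derivMatrix {m n : ℕ} (g : EuclideanSpace ℝ (Fin m) → EuclideanSpace ℝ (Fin n))
    (x : EuclideanSpace ℝ (Fin m)) : Matrix (Fin n) (Fin m) ℝ :=
  Matrix.of fun i j => fderiv ℝ g x (EuclideanSpace.single j 1) i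

/-! ### Positive vectors with given sum and product

The dimension is `n = m + 2`; a point `(x_1, …, x_n)` has the entries `x 0 = x_1`, `x 1 = x_2`,
and the coordinates `(x_3, …, x_n)` are those of a point of `ℝ^m`. -/

/-- The set of positive vectors with `∑ x_i = S` and `∏ x_i = P`. -/
def manifold (m : ℕ) (S P : ℝ) : Set (EuclideanSpace ℝ (Fin (m + 2))) :=
  {x | (∀ i, 0 < x i) ∧ ∑ i, x i = S ∧ ∏ i, x i = P}

/-- The part of the manifold on which `x_1 ≥ x_2`. -/
def manifoldPlus (m : ℕ) (S P : ℝ) : Set (EuclideanSpace ℝ (Fin (m + 2))) :=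
  {x | x ∈ manifold m S P ∧ x 1 ≤ x 0}

/-- The parameter domain: positive vectors `(x_3, …, x_n)` with sum `s < S` and product
`p > 4P/(S - s)²`. -/
def domain (m : ℕ) (S P : ℝ) : Set (EuclideanSpace ℝ (Fin m)) :=
  {y | (∀ i, 0 < y i) ∧ ∑ i, y i < S ∧ 4 * P / (S - ∑ i, y i) ^ 2 < ∏ i, y i}

/-- The larger root of `X² - tX + P/p`, where `t = S - s`. -/
def f₁ (m : ℕ) (S P : ℝ) (y : EuclideanSpace ℝ (Fin m)) : ℝ :=
  ((S - ∑ i, y i) + √((S - ∑ i, y i) ^ 2 - 4 * P / ∏ i, y i)) / 2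

/-- The smaller root of `X² - tX + P/p`, where `t = S - s`. -/
def f₂ (m : ℕ) (S P : ℝ) (y : EuclideanSpace ℝ (Fin m)) : ℝ :=
  ((S - ∑ i, y i) - √((S - ∑ i, y i) ^ 2 - 4 * P / ∏ i, y i)) / 2

/-- The parametrization `(x_3, …, x_n) ↦ (f₁, f₂, x_3, …, x_n)`. -/
def param (m : ℕ) (S P : ℝ) (y : EuclideanSpace ℝ (Fin m)) :
    EuclideanSpace ℝ (Fin (m + 2)) :=
  WithLp.toLp 2 (Matrix.vecCons (f₁ m S P y) (Matrix.vecCons (f₂ m S P y) fun i => y i))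

end FixedSumProduct

end

open FixedSumProduct Matrix

open FixedSumProduct Matrix

namespace FixedSumProduct

open Filter Topology
open scoped NNReal

/-! ### An area formula for injective maps from `ℝ^m` -/

/-! Fixing the last m coordinates leaves two positive numbers with known sum t = S - s and product
P/p, so they are the roots of a quadratic. Positivity of its discriminant t² - 4P/p is the last
condition in `domain`, which gives `image_param`. Where x_1 = x_2 the discriminant vanishes, and the
points lie in an affine image of the zero set of a nonzero polynomial, which is null
(`measure_diagonal_eq_zero`).

The density comes from the area formula `euclideanHausdorffMeasure_image_eq_lintegral`. Near a point
where the derivative is injective, the map and its derivative distort distances by factors within r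
> 1 of each other; a linear injection scales volume by exactly `gramFactor`; countably many small
pieces add up, and r tends to 1. The Jacobian is this same factor (`jacobian_eq_gramFactor`).

The identity block in the derivative of `param` makes it injective and turns the Gram matrix into I
+ CᵀC, where C has the two top rows. The 2×2 formula is then det(I + CᵀC) = det(I + CCᵀ). -/

theorem euclideanHausdorffMeasure_image_le {X Y Z : Type*}
    [EMetricSpace Y] [MeasurableSpace Y] [BorelSpace Y]
    [EMetricSpace Z] [MeasurableSpace Z] [BorelSpace Z] {f : X → Y} {g : X → Z} {s : Set X}
    {C : ℝ≥0} (d : ℕ) (h : ∀ x ∈ s, ∀ y ∈ s, edist (f x) (f y) ≤ C * edist (g x) (g y)) :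
    μHE[d] (f '' s) ≤ (C : ℝ≥0∞) ^ d * μHE[d] (g '' s) := by
  rcases s.eq_empty_or_nonempty with rfl | ⟨x₀, -⟩
  · simp
  have : Nonempty X := ⟨x₀⟩
  set k := Function.invFunOn g s
  have hk : ∀ x ∈ s, k (g x) ∈ s ∧ g (k (g x)) = g x := fun x hx =>
    ⟨Function.invFunOn_mem ⟨x, hx, rfl⟩, Function.invFunOn_eq ⟨x, hx, rfl⟩⟩
  -- The hypothesis forces `f` to be constant on the fibres of `g` in `s`, so `f` factors through
  -- `g` by a `C`-Lipschitz map even if `g` is not injective.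
  have himg : f '' s = (f ∘ k) '' (g '' s) := by
    rw [Set.image_image]
    refine Set.image_congr fun x hx => ?_
    have h0 := h x hx (k (g x)) (hk x hx).1
    rw [(hk x hx).2, edist_self, mul_zero] at h0
    exact edist_le_zero.1 h0
  have hL : LipschitzOnWith C (f ∘ k) (g '' s) := by
    rintro _ ⟨x, hx, rfl⟩ _ ⟨y, hy, rfl⟩
    have := h _ (hk x hx).1 _ (hk y hy).1
    rwa [(hk x hx).2, (hk y hy).2] at this
  have := hL.hausdorffMeasure_image_le (d := d) (Nat.cast_nonneg d)
  rw [ENNReal.rpow_natCast] at this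
  rw [himg, Measure.euclideanHausdorffMeasure_def, Measure.euclideanHausdorffMeasure_def,
    Measure.smul_apply, Measure.smul_apply, ENNReal.smul_def, ENNReal.smul_def, smul_eq_mul,
    smul_eq_mul, mul_left_comm]
  gcongr

/-- Lindelöf gives a countable subcover by the good neighbourhoods, and `disjointed` makes it a
partition. -/
theorem exists_measurable_partition {X : Type*} [TopologicalSpace X]
    [SecondCountableTopology X] [MeasurableSpace X] [OpensMeasurableSpace X] {s : Set X}
    (hs : MeasurableSet s) {p : Set X → Prop}
    (h : ∀ x ∈ s, ∃ N ∈ 𝓝 x, ∀ t ⊆ N, t ⊆ s → MeasurableSet t → p t) (h0 : p ∅) :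
    ∃ t : ℕ → Set X, (∀ i, MeasurableSet (t i)) ∧ Pairwise (Function.onFun Disjoint t) ∧
      (∀ i, p (t i)) ∧ s = ⋃ i, t i := by
  rcases s.eq_empty_or_nonempty with rfl | hne
  · exact ⟨fun _ => ∅, by simp, by simp [Pairwise, Function.onFun], fun _ => h0, by simp⟩
  choose! N hN hp using h
  obtain ⟨c, hcs, hc, hcov⟩ := TopologicalSpace.countable_cover_nhdsWithin (s := s)
    (f := fun x => interior (N x))
    fun x hx => mem_nhdsWithin_of_mem_nhds (interior_mem_nhds.2 (hN x hx))
  have hcne : c.Nonempty := by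
    obtain ⟨x, hx⟩ := hne
    obtain ⟨y, hy, -⟩ := Set.mem_iUnion₂.1 (hcov hx)
    exact ⟨y, hy⟩
  obtain ⟨q, rfl⟩ := hc.exists_eq_range hcne
  have hm : ∀ i, MeasurableSet (disjointed (fun i => interior (N (q i))) i) :=
    MeasurableSet.disjointed fun i => isOpen_interior.measurableSet
  refine ⟨fun i => s ∩ disjointed (fun i => interior (N (q i))) i,
    fun i => hs.inter (hm i), fun i j hij => ?_, fun i => ?_, ?_⟩
  · exact (disjoint_disjointed _ hij).mono Set.inter_subset_right Set.inter_subset_right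
  · exact hp (q i) (hcs ⟨i, rfl⟩) _
      ((Set.inter_subset_right.trans (disjointed_subset _ i)).trans interior_subset)
      Set.inter_subset_left (hs.inter (hm i))
  · rw [← Set.inter_iUnion, iUnion_disjointed, eq_comm, Set.inter_eq_left]
    simpa using hcov

section Area

variable {m : ℕ} {F : Type*} [NormedAddCommGroup F] [InnerProductSpace ℝ F]

/-- An orthonormal basis of the range of `A` identifies it with ℝ^m. This reduces Hausdorff measure
of images under `A` to Lebesgue measure under a square map. -/
theorem exists_eq_isometry_comp {A : EuclideanSpace ℝ (Fin m) →L[ℝ] F}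
    (hA : Function.Injective A) :
    ∃ (Q : EuclideanSpace ℝ (Fin m) →ₗᵢ[ℝ] F)
      (B : EuclideanSpace ℝ (Fin m) →L[ℝ] EuclideanSpace ℝ (Fin m)),
      Function.Injective B ∧ A = Q.toContinuousLinearMap ∘SL B := by
  have hr : Module.finrank ℝ (A : EuclideanSpace ℝ (Fin m) →ₗ[ℝ] F).range = m := by
    rw [LinearMap.finrank_range_of_inj hA]; simp
  let e := ((stdOrthonormalBasis ℝ (A : EuclideanSpace ℝ (Fin m) →ₗ[ℝ] F).range).reindex
    (finCongr hr)).repr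
  let B : EuclideanSpace ℝ (Fin m) →ₗ[ℝ] EuclideanSpace ℝ (Fin m) :=
    e.toLinearEquiv.toLinearMap ∘ₗ (A : EuclideanSpace ℝ (Fin m) →ₗ[ℝ] F).rangeRestrict
  have hc : ∀ x, ((e.symm (B x) : (A : EuclideanSpace ℝ (Fin m) →ₗ[ℝ] F).range) : F) = A x := by
    intro x
    simp [B]
  refine ⟨(Submodule.subtypeₗᵢ _).comp e.symm.toLinearIsometry, B.toContinuousLinearMap, ?_, ?_⟩
  · intro x y hxy
    apply hA
    rw [← hc x, ← hc y]
    exact congrArg (fun z => ((e.symm z : (A : EuclideanSpace ℝ (Fin m) →ₗ[ℝ] F).range) : F)) hxy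
  · ext x
    exact (hc x).symm

/-- An injective strict derivative is metrically equivalent to the map itself, with constants
arbitrarily close to `1`. -/
theorem exists_nhds_edist_comparable {f : EuclideanSpace ℝ (Fin m) → F}
    {A : EuclideanSpace ℝ (Fin m) →L[ℝ] F} {a : EuclideanSpace ℝ (Fin m)}
    (hf : HasStrictFDerivAt f A a) (hA : Function.Injective A) {r : ℝ≥0} (hr : 1 < r) :
    ∃ N ∈ 𝓝 a, (∀ x ∈ N, ∀ y ∈ N, edist (f x) (f y) ≤ r * edist (A x) (A y)) ∧
      ∀ x ∈ N, ∀ y ∈ N, edist (A x) (A y) ≤ r * edist (f x) (f y) := by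
  obtain ⟨K, hK, hAK⟩ :=
    ((A : EuclideanSpace ℝ (Fin m) →ₗ[ℝ] F).injective_iff_antilipschitz).1 hA
  have hr' : (1 : ℝ) < r := by exact_mod_cast hr
  have hr0 : (0 : ℝ) < r := by linarith
  have hK' : (0 : ℝ) < K := by exact_mod_cast hK
  -- Dividing by the antilipschitz constant makes the error at most (1 - 1/r)‖Ax - Ay‖. The lower
  -- bound is then exactly 1/r, and the upper one is 2 - 1/r ≤ r.
  have hpos : 0 < (1 - (r : ℝ)⁻¹) / K := div_pos (sub_pos.2 (inv_lt_one_of_one_lt₀ hr')) hK'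
  have := hf.isLittleO.def hpos
  rw [nhds_prod_eq, Filter.Eventually, mem_prod_same_iff] at this
  obtain ⟨N, hN, hs⟩ := this
  have key : ∀ x ∈ N, ∀ y ∈ N,
      ‖f x - f y - (A x - A y)‖ ≤ (1 - (r : ℝ)⁻¹) * ‖A x - A y‖ := by
    intro x hx y hy
    have h1 : ‖f x - f y - A (x - y)‖ ≤ (1 - (r : ℝ)⁻¹) / K * ‖x - y‖ :=
      hs (Set.mk_mem_prod hx hy)
    have h2 := hAK.le_mul_dist x y
    rw [dist_eq_norm, dist_eq_norm] at h2
    change ‖x - y‖ ≤ K * ‖A x - A y‖ at h2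
    rw [map_sub] at h1
    calc _ ≤ _ := h1
      _ ≤ (1 - (r : ℝ)⁻¹) / K * (K * ‖A x - A y‖) := by gcongr
      _ = _ := by field_simp
  have hri : (r : ℝ) * (r : ℝ)⁻¹ = 1 := mul_inv_cancel₀ hr0.ne'
  have conv : ∀ {u v : F}, ‖u‖ ≤ r * ‖v‖ → (‖u‖ₑ : ℝ≥0∞) ≤ r * ‖v‖ₑ := by
    intro u v h
    rw [enorm_eq_nnnorm, enorm_eq_nnnorm]
    exact_mod_cast h
  refine ⟨N, hN, fun x hx y hy => ?_, fun x hx y hy => ?_⟩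
  · rw [edist_eq_enorm_sub, edist_eq_enorm_sub]
    apply conv
    have h1 := key x hx y hy
    have h2 := norm_le_norm_add_norm_sub (A x - A y) (f x - f y)
    rw [norm_sub_rev (A x - A y)] at h2
    have h3 : 2 - (r : ℝ)⁻¹ ≤ r := by nlinarith [sq_nonneg ((r : ℝ) - 1), inv_pos.2 hr0]
    nlinarith [norm_nonneg (A x - A y)]
  · rw [edist_eq_enorm_sub, edist_eq_enorm_sub]
    apply conv
    have h1 := key x hx y hy
    have h2 := norm_le_norm_add_norm_sub (f x - f y) (A x - A y)
    have h4 : (r : ℝ)⁻¹ * ‖A x - A y‖ ≤ ‖f x - f y‖ := by linarith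
    calc ‖A x - A y‖ = r * ((r : ℝ)⁻¹ * ‖A x - A y‖) := by rw [← mul_assoc, hri, one_mul]
      _ ≤ _ := by gcongr

theorem eventually_le_mul_of_continuousAt {X : Type*} [TopologicalSpace X] {J : X → ℝ≥0∞} {a : X}
    (hJ : ContinuousAt J a) (h0 : J a ≠ 0) (ht : J a ≠ ⊤) {r : ℝ≥0} (hr : 1 < r) :
    ∀ᶠ x in 𝓝 a, J x ≤ r * J a ∧ J a ≤ r * J x := by
  have hr' : (1 : ℝ≥0∞) < r := by exact_mod_cast hr
  have h1 : J a < r * J a := by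
    simpa using ENNReal.mul_lt_mul_left h0 ht hr'
  have h2 : Tendsto (fun x => (r : ℝ≥0∞) * J x) (𝓝 a) (𝓝 (r * J a)) :=
    ENNReal.Tendsto.const_mul hJ (Or.inr ENNReal.coe_ne_top)
  filter_upwards [hJ.eventually_lt_const h1, h2.eventually_const_lt h1] with x hx hy
  exact ⟨hx.le, hy.le⟩

variable [FiniteDimensional ℝ F]

/-- The factor `√det(AᵀA)` by which a linear map `A` multiplies `m`-dimensional volume. -/
noncomputable def gramFactor (A : EuclideanSpace ℝ (Fin m) →L[ℝ] F) : ℝ≥0∞ :=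
  ENNReal.ofReal (√(ContinuousLinearMap.adjoint A ∘SL A).det)

theorem continuous_gramFactor :
    Continuous (gramFactor : (EuclideanSpace ℝ (Fin m) →L[ℝ] F) → ℝ≥0∞) := by
  have h : Continuous fun A : EuclideanSpace ℝ (Fin m) →L[ℝ] F =>
      ContinuousLinearMap.adjoint A ∘SL A :=
    ContinuousLinearMap.adjoint.continuous.clm_comp continuous_id
  exact ENNReal.continuous_ofReal.comp
    (Real.continuous_sqrt.comp (ContinuousLinearMap.continuous_det.comp h))

theorem gramFactor_ne_top (A : EuclideanSpace ℝ (Fin m) →L[ℝ] F) : gramFactor A ≠ ⊤ :=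
  ENNReal.ofReal_ne_top

/-- Since Q*Q = 1, the Gram operator is B*B, with determinant (det B)². -/
theorem gramFactor_isometry_comp (Q : EuclideanSpace ℝ (Fin m) →ₗᵢ[ℝ] F)
    (B : EuclideanSpace ℝ (Fin m) →L[ℝ] EuclideanSpace ℝ (Fin m)) :
    gramFactor (Q.toContinuousLinearMap ∘SL B) = ENNReal.ofReal |B.det| := by
  have h1 : ContinuousLinearMap.adjoint (Q.toContinuousLinearMap ∘SL B) ∘SL
      (Q.toContinuousLinearMap ∘SL B) = ContinuousLinearMap.adjoint B ∘SL B := by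
    rw [ContinuousLinearMap.adjoint_comp, ContinuousLinearMap.comp_assoc,
      ← ContinuousLinearMap.comp_assoc _ _ B, Q.adjoint_comp_self]
    rfl
  have h2 : (ContinuousLinearMap.adjoint B).det = B.det := by
    let b := EuclideanSpace.basisFun (Fin m) ℝ
    have h3 := LinearMap.toMatrix_adjoint b b (B : EuclideanSpace ℝ (Fin m) →ₗ[ℝ] _)
    rw [ContinuousLinearMap.det, ContinuousLinearMap.det, ← LinearMap.det_toMatrix b.toBasis,
      ← LinearMap.det_toMatrix b.toBasis]
    change (LinearMap.toMatrix b.toBasis b.toBasis (LinearMap.adjoint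
      (B : EuclideanSpace ℝ (Fin m) →ₗ[ℝ] _))).det = _
    rw [h3, Matrix.det_conjTranspose]
    simp
  have h4 : (ContinuousLinearMap.adjoint B ∘SL B).det = B.det * B.det := by
    exact (LinearMap.det_comp (ContinuousLinearMap.adjoint B).toLinearMap B.toLinearMap).trans
      (congrArg (· * B.det) h2)
  rw [gramFactor, h1, h4, Real.sqrt_mul_self_eq_abs]

theorem gramFactor_ne_zero {A : EuclideanSpace ℝ (Fin m) →L[ℝ] F} (hA : Function.Injective A) :
    gramFactor A ≠ 0 := by
  obtain ⟨Q, B, hB, rfl⟩ := exists_eq_isometry_comp hA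
  rw [gramFactor_isometry_comp]
  have : B.det ≠ 0 := by
    have hk : (B : EuclideanSpace ℝ (Fin m) →ₗ[ℝ] EuclideanSpace ℝ (Fin m)).ker = ⊥ :=
      LinearMap.ker_eq_bot.2 hB
    intro h0
    exact (LinearMap.bot_lt_ker_of_det_eq_zero h0).ne' hk
  simpa using this

variable [MeasurableSpace F] [BorelSpace F]

theorem euclideanHausdorffMeasure_image_linear {A : EuclideanSpace ℝ (Fin m) →L[ℝ] F}
    (hA : Function.Injective A) (s : Set (EuclideanSpace ℝ (Fin m))) :
    μHE[m] (A '' s) = gramFactor A * volume s := by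
  obtain ⟨Q, B, hB, rfl⟩ := exists_eq_isometry_comp hA
  rw [gramFactor_isometry_comp]
  have : (Q.toContinuousLinearMap ∘SL B) '' s = Q '' (B '' s) := by
    rw [Set.image_image]; rfl
  rw [this, Q.isometry.euclideanHausdorffMeasure_image,
    EuclideanSpace.euclideanHausdorffMeasure_eq_volume,
    Measure.addHaar_image_continuousLinearMap]

/-- In the exponent m + 1, m factors come from replacing `f` by its derivative at `a`, and one from
freezing the continuous density at `a`. -/
theorem exists_nhds_area_comparable {f : EuclideanSpace ℝ (Fin m) → F}
    {a : EuclideanSpace ℝ (Fin m)} {U : Set (EuclideanSpace ℝ (Fin m))} (hU : U ∈ 𝓝 a)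
    (hf : ContDiffOn ℝ 1 f U) (hA : Function.Injective (fderiv ℝ f a)) {r : ℝ≥0} (hr : 1 < r) :
    ∃ N ∈ 𝓝 a, ∀ s ⊆ N, MeasurableSet s →
      μHE[m] (f '' s) ≤ (r : ℝ≥0∞) ^ (m + 1) * ∫⁻ x in s, gramFactor (fderiv ℝ f x) ∧
      ∫⁻ x in s, gramFactor (fderiv ℝ f x) ≤ (r : ℝ≥0∞) ^ (m + 1) * μHE[m] (f '' s) := by
  have hfa := hf.contDiffAt hU
  obtain ⟨N₁, hN₁, h1, h2⟩ :=
    exists_nhds_edist_comparable (hfa.hasStrictFDerivAt one_ne_zero) hA hr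
  have hJ : ContinuousAt (fun x => gramFactor (fderiv ℝ f x)) a :=
    continuous_gramFactor.continuousAt.comp (hfa.continuousAt_fderiv one_ne_zero)
  have hN₂ := eventually_le_mul_of_continuousAt hJ (gramFactor_ne_zero hA)
    (gramFactor_ne_top _) hr
  refine ⟨N₁ ∩ {x | _}, inter_mem hN₁ hN₂, fun s hs hsm => ⟨?_, ?_⟩⟩
  · calc μHE[m] (f '' s) ≤ (r : ℝ≥0∞) ^ m * μHE[m] (fderiv ℝ f a '' s) :=
        euclideanHausdorffMeasure_image_le m
          fun x hx y hy => h1 x (hs hx).1 y (hs hy).1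
      _ = (r : ℝ≥0∞) ^ m * ∫⁻ _ in s, gramFactor (fderiv ℝ f a) := by
        rw [euclideanHausdorffMeasure_image_linear hA, setLIntegral_const]
      _ ≤ (r : ℝ≥0∞) ^ m * ∫⁻ x in s, r * gramFactor (fderiv ℝ f x) := by
        exact mul_le_mul' le_rfl (setLIntegral_mono' hsm fun x hx => (hs hx).2.2)
      _ = _ := by
        rw [lintegral_const_mul' _ _ ENNReal.coe_ne_top, pow_succ, mul_assoc]
  · calc ∫⁻ x in s, gramFactor (fderiv ℝ f x) ≤ ∫⁻ _ in s, r * gramFactor (fderiv ℝ f a) :=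
        setLIntegral_mono' hsm fun x hx => (hs hx).2.1
      _ = r * μHE[m] (fderiv ℝ f a '' s) := by
        rw [euclideanHausdorffMeasure_image_linear hA, setLIntegral_const, mul_assoc]
      _ ≤ r * ((r : ℝ≥0∞) ^ m * μHE[m] (f '' s)) := by
        gcongr
        exact euclideanHausdorffMeasure_image_le m
          fun x hx y hy => h2 x (hs hx).1 y (hs hy).1
      _ = _ := by rw [pow_succ', mul_assoc]

/-- The area formula for an injective `C¹` immersion of an open set of `ℝ^m`. -/
theorem euclideanHausdorffMeasure_image_eq_lintegral {f : EuclideanSpace ℝ (Fin m) → F}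
    {U s : Set (EuclideanSpace ℝ (Fin m))} (hU : IsOpen U) (hf : ContDiffOn ℝ 1 f U)
    (hinj : Set.InjOn f U) (hA : ∀ x ∈ U, Function.Injective (fderiv ℝ f x))
    (hs : MeasurableSet s) (hsU : s ⊆ U) :
    μHE[m] (f '' s) = ∫⁻ x in s, gramFactor (fderiv ℝ f x) := by
  have key : ∀ r : ℝ≥0, 1 < r →
      μHE[m] (f '' s) ≤ (r : ℝ≥0∞) ^ (m + 1) * ∫⁻ x in s, gramFactor (fderiv ℝ f x) ∧
      ∫⁻ x in s, gramFactor (fderiv ℝ f x) ≤ (r : ℝ≥0∞) ^ (m + 1) * μHE[m] (f '' s) := by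
    intro r hr
    obtain ⟨t, htm, htd, hp, rfl⟩ := exists_measurable_partition hs (p := fun s =>
      μHE[m] (f '' s) ≤ (r : ℝ≥0∞) ^ (m + 1) * ∫⁻ x in s, gramFactor (fderiv ℝ f x) ∧
      ∫⁻ x in s, gramFactor (fderiv ℝ f x) ≤ (r : ℝ≥0∞) ^ (m + 1) * μHE[m] (f '' s))
      (fun x hx => by
        obtain ⟨N, hN, h⟩ := exists_nhds_area_comparable (hU.mem_nhds (hsU hx)) hf
          (hA x (hsU hx)) hr
        exact ⟨N, hN, fun t ht _ htm => h t ht htm⟩) (by simp)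
    have hsub : ∀ i, t i ⊆ U := fun i => (Set.subset_iUnion t i).trans hsU
    have himg : μHE[m] (f '' ⋃ i, t i) = ∑' i, μHE[m] (f '' t i) := by
      rw [Set.image_iUnion]
      -- Injectivity keeps the images disjoint, and also makes them measurable (Lusin–Souslin).
      refine measure_iUnion (fun i j hij => ?_) fun i =>
        (htm i).image_of_continuousOn_injOn (hf.continuousOn.mono (hsub i))
          (hinj.mono (hsub i))
      exact Set.disjoint_image_image fun x hx y hy hxy =>
        Set.disjoint_left.1 (htd hij) hx (hinj (hsub i hx) (hsub j hy) hxy ▸ hy)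
    rw [himg, lintegral_iUnion htm htd, ← ENNReal.tsum_mul_left, ← ENNReal.tsum_mul_left]
    exact ⟨ENNReal.tsum_le_tsum fun i => (hp i).1, ENNReal.tsum_le_tsum fun i => (hp i).2⟩
  have lim : ∀ c : ℝ≥0∞, Tendsto (fun r : ℝ≥0 => (r : ℝ≥0∞) ^ (m + 1) * c) (𝓝[>] 1) (𝓝 c) := by
    intro c
    have h1 : Tendsto (fun r : ℝ≥0 => (r : ℝ≥0∞) ^ (m + 1)) (𝓝 1) (𝓝 1) := by
      have : Continuous fun r : ℝ≥0 => ((r ^ (m + 1) : ℝ≥0) : ℝ≥0∞) := by fun_prop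
      simpa using this.tendsto 1
    simpa using ENNReal.Tendsto.mul_const (b := c) (h1.mono_left nhdsWithin_le_nhds)
      (Or.inl one_ne_zero)
  exact le_antisymm
    (ge_of_tendsto (lim _) (eventually_mem_nhdsWithin.mono fun r hr => (key r hr).1))
    (ge_of_tendsto (lim _) (eventually_mem_nhdsWithin.mono fun r hr => (key r hr).2))

end Area

end FixedSumProduct

namespace FixedSumProduct

/-! ### The Jacobian as a Gram determinant -/

theorem volume_unitCube (k : ℕ) : volume (unitCube k) = 1 := by
  have h : unitCube k = WithLp.ofLp ⁻¹' (Set.Icc (0 : Fin k → ℝ) 1) := by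
    ext u
    simp [unitCube, Pi.le_def, forall_and]
  rw [h, (PiLp.volume_preserving_ofLp (Fin k)).measure_preimage
    measurableSet_Icc.nullMeasurableSet, Real.volume_Icc_pi]
  simp

/-- The cubes have full dimension m, so all have volume 1 and the supremum is over a constant. -/
theorem jacobian_eq_gramFactor {m n : ℕ}
    {g : EuclideanSpace ℝ (Fin m) → EuclideanSpace ℝ (Fin n)} {x : EuclideanSpace ℝ (Fin m)}
    (h : Function.Injective (fderiv ℝ g x)) :
    jacobian m g x = gramFactor (fderiv ℝ g x) := by
  have hQ : ∀ Q : EuclideanSpace ℝ (Fin m) →ₗᵢ[ℝ] EuclideanSpace ℝ (Fin m),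
      μHE[m] (fderiv ℝ g x '' (Q '' unitCube m)) = gramFactor (fderiv ℝ g x) := by
    intro Q
    rw [euclideanHausdorffMeasure_image_linear h,
      ← EuclideanSpace.euclideanHausdorffMeasure_eq_volume,
      Q.isometry.euclideanHausdorffMeasure_image,
      EuclideanSpace.euclideanHausdorffMeasure_eq_volume, volume_unitCube, mul_one]
  have : Nonempty (EuclideanSpace ℝ (Fin m) →ₗᵢ[ℝ] EuclideanSpace ℝ (Fin m)) :=
    ⟨LinearIsometry.id⟩
  simp_rw [jacobian, hQ]
  exact ciSup_const

theorem gramFactor_fderiv_toReal_sq {m n : ℕ}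
    (g : EuclideanSpace ℝ (Fin m) → EuclideanSpace ℝ (Fin n)) (x : EuclideanSpace ℝ (Fin m)) :
    (gramFactor (fderiv ℝ g x)).toReal ^ 2 =
      ((derivMatrix g x)ᵀ * derivMatrix g x).det := by
  let b := EuclideanSpace.basisFun (Fin m) ℝ
  let c := EuclideanSpace.basisFun (Fin n) ℝ
  let A : EuclideanSpace ℝ (Fin m) →ₗ[ℝ] EuclideanSpace ℝ (Fin n) := fderiv ℝ g x
  have hM : LinearMap.toMatrix b.toBasis c.toBasis A = derivMatrix g x := by
    ext i j
    simp [LinearMap.toMatrix_apply, derivMatrix, b, c, A]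
  have hdet : (ContinuousLinearMap.adjoint (fderiv ℝ g x) ∘SL fderiv ℝ g x).det =
      ((derivMatrix g x)ᵀ * derivMatrix g x).det := by
    rw [ContinuousLinearMap.det, ← LinearMap.det_toMatrix b.toBasis]
    change (LinearMap.toMatrix b.toBasis b.toBasis (LinearMap.adjoint A ∘ₗ A)).det = _
    rw [LinearMap.toMatrix_comp b.toBasis c.toBasis b.toBasis, LinearMap.toMatrix_adjoint, hM,
      conjTranspose_eq_transpose_of_trivial]
  have hnn : 0 ≤ ((derivMatrix g x)ᵀ * derivMatrix g x).det := by
    rw [← conjTranspose_eq_transpose_of_trivial]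
    exact (posSemidef_conjTranspose_mul_self _).det_nonneg
  rw [gramFactor, hdet, ENNReal.toReal_ofReal (Real.sqrt_nonneg _), Real.sq_sqrt hnn]

theorem det_transpose_mul_self_vecCons_one {m : ℕ} (V W : Fin m → ℝ) :
    ((of (vecCons V (vecCons W (1 : Matrix (Fin m) (Fin m) ℝ))))ᵀ *
      of (vecCons V (vecCons W (1 : Matrix (Fin m) (Fin m) ℝ)))).det =
    (1 + !![V ⬝ᵥ V, V ⬝ᵥ W; V ⬝ᵥ W, W ⬝ᵥ W] : Matrix (Fin 2) (Fin 2) ℝ).det := by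
  have h1 : (of (vecCons V (vecCons W (1 : Matrix (Fin m) (Fin m) ℝ))))ᵀ *
      of (vecCons V (vecCons W (1 : Matrix (Fin m) (Fin m) ℝ))) =
      1 + (of ![V, W])ᵀ * of ![V, W] := by
    ext i j
    have h2 : ∑ k, (1 : Matrix (Fin m) (Fin m) ℝ) k i * (1 : Matrix (Fin m) (Fin m) ℝ) k j =
        (1 : Matrix (Fin m) (Fin m) ℝ) i j := by
      simp [one_apply, eq_comm]
    rw [Matrix.add_apply, mul_apply, mul_apply, Fin.sum_univ_succ, Fin.sum_univ_succ,
      Fin.sum_univ_two]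
    change V i * V j + (W i * W j + ∑ k, (1 : Matrix (Fin m) (Fin m) ℝ) k i *
      (1 : Matrix (Fin m) (Fin m) ℝ) k j) = _ + (V i * V j + W i * W j)
    rw [h2]
    ring
  have h2 : of ![V, W] * (of ![V, W])ᵀ = !![V ⬝ᵥ V, V ⬝ᵥ W; V ⬝ᵥ W, W ⬝ᵥ W] := by
    ext i j
    fin_cases i <;> fin_cases j <;> simp [mul_apply, dotProduct, mul_comm]
  rw [h1, det_one_add_mul_comm, h2]

end FixedSumProduct

namespace FixedSumProduct

open scoped NNReal

/-! ### The parametrization of the manifold -/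

section Param

variable {m : ℕ} {S P : ℝ}

@[simp] theorem param_zero (y : EuclideanSpace ℝ (Fin m)) : param m S P y 0 = f₁ m S P y := rfl

@[simp] theorem param_one (y : EuclideanSpace ℝ (Fin m)) : param m S P y 1 = f₂ m S P y := rfl

@[simp] theorem param_succ_succ (y : EuclideanSpace ℝ (Fin m)) (i : Fin m) :
    param m S P y i.succ.succ = y i := rfl

theorem prod_pos_of_mem_domain {y : EuclideanSpace ℝ (Fin m)} (hy : y ∈ domain m S P) :
    0 < ∏ i, y i :=
  Finset.prod_pos fun i _ => hy.1 i

theorem discrim_pos_of_mem_domain {y : EuclideanSpace ℝ (Fin m)} (hy : y ∈ domain m S P) :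
    0 < (S - ∑ i, y i) ^ 2 - 4 * P / ∏ i, y i := by
  have ht : 0 < S - ∑ i, y i := sub_pos.2 hy.2.1
  have h := hy.2.2
  rw [div_lt_iff₀ (by positivity)] at h
  rw [sub_pos, div_lt_iff₀ (prod_pos_of_mem_domain hy)]
  linarith

theorem isOpen_domain : IsOpen (domain m S P) := by
  have h : domain m S P = (⋂ i, {y : EuclideanSpace ℝ (Fin m) | 0 < y i}) ∩
      ({y | ∑ i, y i < S} ∩ {y | 4 * P < (∏ i, y i) * (S - ∑ i, y i) ^ 2}) := by
    ext y
    simp only [domain, Set.mem_ofPred_eq, Set.mem_inter_iff, Set.mem_iInter]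
    refine and_congr_right fun _ => and_congr_right fun hs => ?_
    have ht : 0 < S - ∑ i, y i := sub_pos.2 hs
    rw [div_lt_iff₀ (by positivity)]
  rw [h]
  refine (isOpen_iInter_of_finite fun i => isOpen_lt (by fun_prop) (by fun_prop)).inter
    ((isOpen_lt (by fun_prop) (by fun_prop)).inter (isOpen_lt (by fun_prop) (by fun_prop)))

theorem contDiffOn_sqrt_discrim :
    ContDiffOn ℝ ∞ (fun y : EuclideanSpace ℝ (Fin m) =>
      √((S - ∑ i, y i) ^ 2 - 4 * P / ∏ i, y i)) (domain m S P) := by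
  refine ContDiffOn.sqrt ?_ fun y hy => (discrim_pos_of_mem_domain hy).ne'
  refine ContDiffOn.sub (ContDiff.contDiffOn (by fun_prop)) ?_
  refine ContDiffOn.div contDiffOn_const (ContDiff.contDiffOn ?_)
    fun y hy => (prod_pos_of_mem_domain hy).ne'
  exact contDiff_prod fun i _ => by fun_prop

theorem contDiffOn_param : ContDiffOn ℝ ∞ (param m S P) (domain m S P) := by
  have ht : ContDiffOn ℝ ∞ (fun y : EuclideanSpace ℝ (Fin m) => S - ∑ i, y i)
      (domain m S P) := ContDiff.contDiffOn (by fun_prop)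
  rw [contDiffOn_euclidean]
  intro i
  refine Fin.cases ?_ (fun i => Fin.cases ?_ (fun i => ?_) i) i
  · exact (ht.add contDiffOn_sqrt_discrim).div_const 2
  · exact (ht.sub contDiffOn_sqrt_discrim).div_const 2
  · exact ContDiff.contDiffOn (f := fun y : EuclideanSpace ℝ (Fin m) => y i) (by fun_prop)

theorem injective_param : Function.Injective (param m S P) := by
  intro y z h
  ext i
  exact congrArg (fun x : EuclideanSpace ℝ (Fin (m + 2)) => x i.succ.succ) h

/-- Division and square root are total, so this holds on all of ℝ^m, as the pushforward by `param`
requires no restriction to `domain`. -/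
theorem measurable_param : Measurable (param m S P) := by
  refine (WithLp.measurable_toLp 2 _).comp (measurable_pi_lambda _ fun i => ?_)
  refine Fin.cases ?_ (fun i => Fin.cases ?_ (fun i => ?_) i) i
  · change Measurable (f₁ m S P)
    unfold f₁
    fun_prop
  · change Measurable (f₂ m S P)
    unfold f₂
    fun_prop
  · change Measurable fun y : EuclideanSpace ℝ (Fin m) => y i
    fun_prop

theorem mem_manifold_iff {x : EuclideanSpace ℝ (Fin (m + 2))} :
    x ∈ manifold m S P ↔ (0 < x 0 ∧ 0 < x 1 ∧ ∀ i : Fin m, 0 < x i.succ.succ) ∧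
      x 0 + x 1 + ∑ i : Fin m, x i.succ.succ = S ∧
      x 0 * x 1 * ∏ i : Fin m, x i.succ.succ = P := by
  simp [manifold, Fin.forall_fin_succ, Fin.sum_univ_succ, Fin.prod_univ_succ, add_assoc, mul_assoc]

theorem param_mem_manifold (hP : 0 < P) {y : EuclideanSpace ℝ (Fin m)}
    (hy : y ∈ domain m S P) : param m S P y ∈ manifold m S P ∧ f₂ m S P y < f₁ m S P y := by
  have ht : 0 < S - ∑ i, y i := sub_pos.2 hy.2.1
  have hp := prod_pos_of_mem_domain hy
  have hd := discrim_pos_of_mem_domain hy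
  have hq : 0 < 4 * P / ∏ i, y i := by positivity
  have hr := Real.sqrt_pos.2 hd
  have hsq := Real.sq_sqrt hd.le
  -- This is positivity of the smaller root.
  have hlt : √((S - ∑ i, y i) ^ 2 - 4 * P / ∏ i, y i) < S - ∑ i, y i := by
    rw [Real.sqrt_lt' ht]; linarith
  refine ⟨mem_manifold_iff.2 ⟨⟨?_, ?_, hy.1⟩, ?_, ?_⟩, ?_⟩
  · rw [param_zero, f₁]; linarith
  · rw [param_one, f₂]; linarith
  · simp only [param_zero, param_one, param_succ_succ, f₁, f₂]; ring
  · simp only [param_zero, param_one, param_succ_succ, f₁, f₂]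
    have : ((S - ∑ i, y i) + √((S - ∑ i, y i) ^ 2 - 4 * P / ∏ i, y i)) / 2 *
        (((S - ∑ i, y i) - √((S - ∑ i, y i) ^ 2 - 4 * P / ∏ i, y i)) / 2) = P / ∏ i, y i := by
      have : P / ∏ i, y i = (4 * P / ∏ i, y i) / 4 := by ring
      rw [this]
      linear_combination (-1 / 4) * hsq
    rw [this, div_mul_cancel₀ _ hp.ne']
  · rw [f₁, f₂]; linarith

theorem image_param (hP : 0 < P) :
    param m S P '' domain m S P = {x | x ∈ manifoldPlus m S P ∧ x 1 < x 0} := by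
  ext x
  constructor
  · rintro ⟨y, hy, rfl⟩
    have h := param_mem_manifold hP hy
    exact ⟨⟨h.1, h.2.le⟩, h.2⟩
  · rintro ⟨⟨hx, -⟩, hlt⟩
    obtain ⟨⟨h0, h1, hpos⟩, hsum, hprod⟩ := mem_manifold_iff.1 hx
    set y : EuclideanSpace ℝ (Fin m) := WithLp.toLp 2 fun i => x i.succ.succ with hy
    have hp : 0 < ∏ i, y i := Finset.prod_pos fun i _ => hpos i
    have hs : S - ∑ i, y i = x 0 + x 1 := by rw [← hsum]; simp [hy]
    have hP' : P = x 0 * x 1 * ∏ i, y i := hprod.symm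
    have hd : (S - ∑ i, y i) ^ 2 - 4 * P / ∏ i, y i = (x 0 - x 1) ^ 2 := by
      rw [hs, hP']; field_simp; ring
    have hr : √((S - ∑ i, y i) ^ 2 - 4 * P / ∏ i, y i) = x 0 - x 1 := by
      rw [hd, Real.sqrt_sq (sub_pos.2 hlt).le]
    refine ⟨y, ⟨hpos, by linarith, ?_⟩, ?_⟩
    · rw [hs, div_lt_iff₀ (by positivity)]
      -- Uses (x_1 + x_2)² = 4x_1x_2 + (x_1 - x_2)², multiplied by p.
      nlinarith [mul_pos hp (pow_pos (sub_pos.2 hlt) 2)]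
    · ext i
      refine Fin.cases ?_ (fun i => Fin.cases ?_ (fun i => rfl) i) i
      · rw [param_zero, f₁, hr, hs]; ring
      · change param m S P y 1 = x 1
        rw [param_one, f₂, hr, hs]; ring

theorem fderiv_param_apply {y : EuclideanSpace ℝ (Fin m)} (hy : y ∈ domain m S P)
    (i : Fin (m + 2)) (v : EuclideanSpace ℝ (Fin m)) :
    fderiv ℝ (param m S P) y v i = fderiv ℝ (fun z => param m S P z i) y v := by
  have hd : HasStrictFDerivAt (param m S P) (fderiv ℝ (param m S P) y) y :=
    (contDiffOn_param.contDiffAt (isOpen_domain.mem_nhds hy)).hasStrictFDerivAt (by simp)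
  rw [(hasStrictFDerivAt_euclidean.1 hd i).hasFDerivAt.fderiv]
  rfl

theorem fderiv_param_succ_succ {y : EuclideanSpace ℝ (Fin m)} (hy : y ∈ domain m S P)
    (i : Fin m) (v : EuclideanSpace ℝ (Fin m)) :
    fderiv ℝ (param m S P) y v i.succ.succ = v i := by
  have h : HasFDerivAt (fun z => param m S P z i.succ.succ)
      (EuclideanSpace.proj i : EuclideanSpace ℝ (Fin m) →L[ℝ] ℝ) y :=
    (EuclideanSpace.proj i : EuclideanSpace ℝ (Fin m) →L[ℝ] ℝ).hasFDerivAt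
  rw [fderiv_param_apply hy, h.fderiv]
  rfl

theorem derivMatrix_param {y : EuclideanSpace ℝ (Fin m)} (hy : y ∈ domain m S P) :
    derivMatrix (param m S P) y =
      Matrix.of (vecCons (partials (f₁ m S P) y)
        (vecCons (partials (f₂ m S P) y) (1 : Matrix (Fin m) (Fin m) ℝ))) := by
  ext i j
  rw [derivMatrix, of_apply]
  refine Fin.cases ?_ (fun i => Fin.cases ?_ (fun i => ?_) i) i
  · exact fderiv_param_apply hy 0 _
  · exact fderiv_param_apply hy 1 _
  · change _ = (1 : Matrix (Fin m) (Fin m) ℝ) i j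
    rw [fderiv_param_succ_succ hy]
    simp [one_apply]

theorem injective_fderiv_param {y : EuclideanSpace ℝ (Fin m)} (hy : y ∈ domain m S P) :
    Function.Injective (fderiv ℝ (param m S P) y) := by
  intro v w h
  ext i
  rw [← fderiv_param_succ_succ hy i v, ← fderiv_param_succ_succ hy i w, h]

/-! ### The part of the manifold with `x_1 = x_2` -/

/-- On each line in the first coordinate direction the equation is polynomial in one variable, with
finitely many roots; Fubini concludes. -/
theorem volume_discrim_eq_zero (hm : 1 ≤ m) (hP : P ≠ 0) :
    volume {y : EuclideanSpace ℝ (Fin m) | (S - ∑ i, y i) ^ 2 * ∏ i, y i = 4 * P} = 0 := by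
  obtain ⟨k, rfl⟩ := Nat.exists_eq_add_of_le' hm
  have hmeas : MeasurableSet
      {y : EuclideanSpace ℝ (Fin (k + 1)) | (S - ∑ i, y i) ^ 2 * ∏ i, y i = 4 * P} :=
    measurableSet_eq_fun (by fun_prop) (by fun_prop)
  let L : ℝ →ₗ[ℝ] EuclideanSpace ℝ (Fin (k + 1)) :=
    LinearMap.toSpanSingleton ℝ _ (EuclideanSpace.single 0 1)
  have key := (ae_ae_add_linearMap_mem_iff L volume volume hmeas.compl).1
    (Filter.Eventually.of_forall fun y => by
      let p : Polynomial ℝ := (Polynomial.C (S - ∑ i, y i) - Polynomial.X) ^ 2 *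
        ((Polynomial.C (y 0) + Polynomial.X) * Polynomial.C (∏ i : Fin k, y i.succ)) -
        Polynomial.C (4 * P)
      have hp : p ≠ 0 := by
        intro h0
        -- At t = -y_0 the product vanishes, leaving -4P ≠ 0.
        have := congrArg (Polynomial.eval (-y 0)) h0
        simp [p, hP] at this
      have hfin : ((p.roots.toFinset : Finset ℝ) : Set ℝ).Finite := Finset.finite_toSet _
      filter_upwards [compl_mem_ae_iff.2 (hfin.measure_zero volume)] with t ht hmem
      apply ht
      have he : (S - ∑ i, (y + L t) i) ^ 2 * ∏ i, (y + L t) i = 4 * P := hmem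
      rw [Finset.mem_coe, Multiset.mem_toFinset, Polynomial.mem_roots hp, Polynomial.IsRoot.def]
      simp only [Fin.sum_univ_succ, Fin.prod_univ_succ] at he
      simp [L] at he
      simp [p, Fin.sum_univ_succ, Polynomial.eval_finsetSum, Polynomial.eval_prod]
      linear_combination he)
  simpa [ae_iff] using key

theorem measure_diagonal_eq_zero (hm : 1 ≤ m) (hP : P ≠ 0) :
    μHE[m] {x | x ∈ manifold m S P ∧ x 0 = x 1} = 0 := by
  -- Linear part of the Lipschitz map y ↦ ((S - s)/2, (S - s)/2, y), which recovers a diagonal point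
  -- from its last m coordinates.
  let L₀ : EuclideanSpace ℝ (Fin m) →ₗ[ℝ] EuclideanSpace ℝ (Fin (m + 2)) :=
    { toFun := fun y => WithLp.toLp 2
        (vecCons (-(∑ i, y i) / 2) (vecCons (-(∑ i, y i) / 2) fun i => y i))
      map_add' := fun y z => by
        ext i
        refine Fin.cases ?_ (fun i => Fin.cases ?_ (fun i => ?_) i) i
        · simp [Finset.sum_add_distrib]; ring
        · simp [Finset.sum_add_distrib]; ring
        · simp
      map_smul' := fun c y => by
        ext i
        refine Fin.cases ?_ (fun i => Fin.cases ?_ (fun i => ?_) i) i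
        · simp [← Finset.mul_sum]; ring
        · simp [← Finset.mul_sum]; ring
        · simp }
  let L := L₀.toContinuousLinearMap
  let c : EuclideanSpace ℝ (Fin (m + 2)) :=
    WithLp.toLp 2 (vecCons (S / 2) (vecCons (S / 2) fun _ => 0))
  let Z := {y : EuclideanSpace ℝ (Fin m) | (S - ∑ i, y i) ^ 2 * ∏ i, y i = 4 * P}
  have hZ : μHE[m] ((fun y => c + L y) '' Z) = 0 := by
    have h := euclideanHausdorffMeasure_image_le (f := fun y => c + L y) (g := id) (s := Z)
      (C := ‖L‖₊) m fun x _ y _ => by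
        rw [edist_add_left]
        exact L.lipschitz x y
    rw [Set.image_id, EuclideanSpace.euclideanHausdorffMeasure_eq_volume,
      volume_discrim_eq_zero hm hP, mul_zero] at h
    exact le_antisymm h zero_le
  refine measure_mono_null ?_ hZ
  rintro x ⟨hx, heq⟩
  obtain ⟨-, hsum, hprod⟩ := mem_manifold_iff.1 hx
  refine ⟨WithLp.toLp 2 fun i => x i.succ.succ, ?_, ?_⟩
  · change (S - ∑ i : Fin m, x i.succ.succ) ^ 2 * ∏ i : Fin m, x i.succ.succ = 4 * P
    rw [← hsum, ← hprod, heq]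
    ring
  · ext i
    refine Fin.cases ?_ (fun i => Fin.cases ?_ (fun i => ?_) i) i
    · change S / 2 + -(∑ i : Fin m, x i.succ.succ) / 2 = x 0
      linarith
    · change S / 2 + -(∑ i : Fin m, x i.succ.succ) / 2 = x 1
      linarith
    · exact zero_add _

end Param

end FixedSumProduct

theorem proposition1 (m : ℕ) (hm : 1 ≤ m) (S P : ℝ) (hS : 0 < S) (hP : 0 < P) :
    -- `param` is a smooth one-to-one parametrization, by the open set `domain`, of `manifoldPlus`
    -- without its part `x_1 = x_2`, which has area zero
    IsOpen (domain m S P) ∧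
    ContDiffOn ℝ ∞ (param m S P) (domain m S P) ∧
    Set.InjOn (param m S P) (domain m S P) ∧
    param m S P '' domain m S P = {x | x ∈ manifoldPlus m S P ∧ x 1 < x 0} ∧
    μHE[m] (manifoldPlus m S P \ param m S P '' domain m S P) = 0 ∧
    -- area measure on `manifoldPlus` has the density `J_m` in these coordinates
    (μHE[m] : Measure (EuclideanSpace ℝ (Fin (m + 2)))).restrict (manifoldPlus m S P) =
      Measure.map (param m S P)
        ((volume.restrict (domain m S P)).withDensity (jacobian m (param m S P))) ∧
    -- the derivative matrix and the formula for `J_m`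
    ∀ y ∈ domain m S P,
      derivMatrix (param m S P) y =
        Matrix.of (vecCons (partials (f₁ m S P) y)
          (vecCons (partials (f₂ m S P) y) (1 : Matrix (Fin m) (Fin m) ℝ))) ∧
      jacobian m (param m S P) y ≠ ⊤ ∧
      ∀ V W : Fin m → ℝ,
        V = derivMatrix (param m S P) y 0 → W = derivMatrix (param m S P) y 1 →
        (jacobian m (param m S P) y).toReal ^ 2 =
          (1 + !![V ⬝ᵥ V, V ⬝ᵥ W; V ⬝ᵥ W, W ⬝ᵥ W] : Matrix (Fin 2) (Fin 2) ℝ).det := by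
  have hnull : μHE[m] (manifoldPlus m S P \ param m S P '' domain m S P) = 0 := by
    refine measure_mono_null ?_ (measure_diagonal_eq_zero (S := S) hm hP.ne')
    rintro x ⟨hx, hn⟩
    rw [image_param hP] at hn
    exact ⟨hx.1, le_antisymm (not_lt.1 fun h => hn ⟨hx, h⟩) hx.2⟩
  have hJ : ∀ y ∈ domain m S P,
      jacobian m (param m S P) y = gramFactor (fderiv ℝ (param m S P) y) :=
    fun y hy => jacobian_eq_gramFactor (injective_fderiv_param hy)
  refine ⟨isOpen_domain, contDiffOn_param, injective_param.injOn, image_param hP, hnull, ?_,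
    fun y hy => ⟨derivMatrix_param hy, ?_, ?_⟩⟩
  · have hsub : param m S P '' domain m S P ⊆ manifoldPlus m S P := by
      rw [image_param hP]
      exact fun x hx => hx.1
    have hae : (manifoldPlus m S P : Set (EuclideanSpace ℝ (Fin (m + 2)))) =ᵐ[μHE[m]]
        param m S P '' domain m S P :=
      (ae_le_set.2 hnull).antisymm hsub.eventuallyLE
    ext B hB
    have hpre : MeasurableSet (param m S P ⁻¹' B) := measurable_param hB
    have hset : B ∩ param m S P '' domain m S P =
        param m S P '' (param m S P ⁻¹' B ∩ domain m S P) :=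
      (Set.image_preimage_inter _ _ _).symm
    have hmeas : MeasurableSet (param m S P ⁻¹' B ∩ domain m S P) :=
      hpre.inter isOpen_domain.measurableSet
    rw [Measure.restrict_congr_set hae, Measure.restrict_apply hB, hset,
      Measure.map_apply measurable_param hB, withDensity_apply _ hpre,
      Measure.restrict_restrict hpre,
      euclideanHausdorffMeasure_image_eq_lintegral isOpen_domain
        (contDiffOn_param.of_le (by simp)) injective_param.injOn
        (fun y hy => injective_fderiv_param hy) hmeas Set.inter_subset_right]
    exact (setLIntegral_congr_fun hmeas fun y hy => hJ y hy.2).symm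
  · rw [hJ y hy]
    exact gramFactor_ne_top _
  · rintro V W rfl rfl
    rw [hJ y hy, gramFactor_fderiv_toReal_sq, derivMatrix_param hy]
    exact det_transpose_mul_self_vecCons_one _ _
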